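/- Let $\mathcal C$ be a locally finitely presented Grothendieck category. A \emph{localizing subcategory} of $\mathcal C$ is a full Serre subcategory $\mathcal S$ (containing $0$ and closed under isomorphisms, subobjects, quotients and extensions) that is closed under direct limits; $t_{\mathcal S}(X)$ denotes the largest subobject of $X$ belonging to $\mathcal S$. The quotient category $\mathcal C/\mathcal S$ is the full subcategory of \emph{$\mathcal S$-closed} objects, i.e. of those $M\in\mathcal C$ with $\operatorname{Hom}(X,M)=\operatorname{Ext}^1(X,M)=0$ for all $X\in\mathcal S$. A localizing subcategory $\mathcal S$ is \emph{of finite type} if the inclusion functor $\mathcal C/\mathcal S\to\mathcal C$ preserves directed sums, i.e. directed unions of subobjects (equivalently, colimits of directed systems of monomorphisms). The \emph{join} of a collection of localizing subcategories is the smallest localizing subcategory containing all of them. Let $\operatorname{Inj}\mathcal C$ be the injective spectrum, the set of isomorphism classes of indecomposable injective objects of $\mathcal C$, and for a localizing subcategory $\mathcal S$ of finite type put $$O(\mathcal S)=\{E\in\operatorname{Inj}\mathcal C \mid t_{\mathcal S}(E)\neq 0\}.$$ Then the following hold. (1) The collection of all sets $O(\mathcal S)$, with $\mathcal S$ a localizing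 subcategory of finite type in $\mathcal C$, is the collection of open sets of a topology on $\operatorname{Inj}\mathcal C$ (the fl-topology). (2) The map $\mathcal S\mapsto O(\mathcal S)$ is a bijection between the localizing subcategories of finite type in $\mathcal C$ and the open subsets for the fl-topology, and it preserves and reflects inclusions: for $\mathcal S,\mathcal Q$ of finite type, $\mathcal S\subseteq\mathcal Q$ if and only if $O(\mathcal S)\subseteq O(\mathcal Q)$. (3) The intersection of finitely many localizing subcategories of finite type is a localizing subcategory of finite type, and the join of an arbitrary collection of localizing subcategories of finite type is a localizing subcategory of finite type. -/

import Mathlib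

universe v u

open CategoryTheory CategoryTheory.Limits Topology

noncomputable section

namespace FiniteLocalization

variable {C : Type u} [Category.{v} C] [Abelian C]

/-- A (full, replete) subcategory of a Grothendieck category is localizing if it is a Serre
subcategory which is closed under direct limits. -/
structure IsLocalizing (S : ObjectProperty C) : Prop where
  isSerreClass : S.IsSerreClass
  closed_directLimit : ∀ (J : Type v) [SmallCategory J] [IsFiltered J],
    S.IsClosedUnderColimitsOfShape J

/-- `surd X` is the smallest localizing subcategory containing `X`, that is, the intersection of
all localizing subcategories that contain `X`. -/
def surd (X : ObjectProperty C) : ObjectProperty C :=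
  fun A => ∀ S : ObjectProperty C, IsLocalizing S → X ≤ S → S A

/-- The intersection of a collection of subcategories. -/
def inter (F : Set (ObjectProperty C)) : ObjectProperty C :=
  fun A => ∀ S ∈ F, S A

/-- The union of a collection of subcategories. -/
def union (F : Set (ObjectProperty C)) : ObjectProperty C :=
  fun A => ∃ S ∈ F, S A

/-- The join of a collection of subcategories: the smallest localizing subcategory containing
all of them. -/
def join (F : Set (ObjectProperty C)) : ObjectProperty C :=
  surd (union F)

variable [IsGrothendieckAbelian.{v} C]

/-- The `S`-closed objects: those `M` with `Hom(X, M) = 0` and `Ext¹(X, M) = 0` for all `X` in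
`S`. -/
def closedObjects (S : ObjectProperty C) : ObjectProperty C :=
  fun M => ∀ X : C, S X → Subsingleton (X ⟶ M) ∧ Subsingleton (Abelian.Ext.{v} X M 1)

/-- The quotient category `C/S`, realized as the full subcategory of `S`-closed objects. -/
abbrev QuotientCategory (S : ObjectProperty C) : Type u :=
  (closedObjects S).FullSubcategory

/-- The inclusion functor `i : C/S ⥤ C`. -/
abbrev inclusion (S : ObjectProperty C) : QuotientCategory S ⥤ C :=
  (closedObjects S).ι

/-- A localizing subcategory `S` is of finite type if the inclusion `i : C/S ⥤ C` preserves
directed sums (directed unions of subobjects), that is, colimits of directed systems in `C/S`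
all of whose transition morphisms are monomorphisms of `C/S`. -/
structure IsFiniteType (S : ObjectProperty C) : Prop where
  isLocalizing : IsLocalizing S
  preservesDirectedSums : ∀ (J : Type v) [Preorder J] [IsDirectedOrder J] [Nonempty J]
    (F : J ⥤ QuotientCategory S), (∀ (i j : J) (f : i ⟶ j), Mono (F.map f)) →
      PreservesColimit F (inclusion S)

/-- The torsion part `t_S(X)`: the largest subobject of `X` belonging to `S`, as the sum of all
subobjects of `X` that belong to `S`. -/
def torsion (S : ObjectProperty C) (X : C) : Subobject X :=
  sSup {Y : Subobject X | S (Y : C)}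

variable (C)

/-- The indecomposable (in particular nonzero) injective objects. -/
def indecomposableInjectives : ObjectProperty C :=
  fun E => Injective E ∧ Indecomposable E

/-- The injective spectrum: isomorphism classes of indecomposable injective objects. -/
def InjSpectrum : Type u :=
  Quotient (isIsomorphicSetoid (indecomposableInjectives C).FullSubcategory)

variable {C}

/-- The isomorphism class of an indecomposable injective object. -/
def InjSpectrum.mk (E : (indecomposableInjectives C).FullSubcategory) : InjSpectrum C :=
  Quotient.mk (isIsomorphicSetoid (indecomposableInjectives C).FullSubcategory) E

/-- `O(S)`: the classes of the indecomposable injective objects `E` with `t_S(E) ≠ 0`. -/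
def openSet (S : ObjectProperty C) : Set (InjSpectrum C) :=
  {x | ∃ E : (indecomposableInjectives C).FullSubcategory,
    InjSpectrum.mk E = x ∧ torsion S E.obj ≠ ⊥}

end FiniteLocalization

end

/-! ### Finitely presentable objects and directed sums of subobjects. -/

namespace FiniteLocalization

variable {C : Type u} [Category.{v} C]

/-! Everything rests on an intrinsic criterion (`IsFinitelyDetermined`): a localizing `S` is of
finite type iff every `f : P ⟶ X` with `P` finitely presentable and `X` in `S` is killed by some `q
: Q ⟶ P` with `Q` finitely presentable and `cokernel q` in `S`. For one direction, `P` modulo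
torsion is embedded in a torsion-free injective object, where finite type makes directed sums of
saturated subobjects saturated (`IsFiniteType.isFinitelyDetermined`). For the other, the criterion
shows that directed unions of closed objects, formed in `C`, are closed
(`IsFinitelyDetermined.closed_of_isColimit`).

The criterion passes to finite intersections by taking biproducts of the objects `Q`. For a join
`T`, the objects satisfying the criterion relative to `T` form a localizing subcategory containing
every member of the family, hence containing `T` (`isFiniteType_join`).

On the spectrum, joins give unions because the objects without nonzero morphisms to a fixed
injective form a localizing subcategory, and binary intersections give intersections because nonzero
subobjects of an indecomposable injective are essential. Injectivity and reflection of inclusions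
come from `exists_indecomposable_injective`: if `S` is not contained in `Q`, finite presentability
and Zorn's lemma give an object `V` of `S`, not in `Q`, all of whose proper quotients are in `Q`.
Such a `V` is uniform and `Q`-torsion-free, so its injective hull is an indecomposable injective
lying in `O(S)` but not in `O(Q)`. -/

theorem exists_colimitPresentation [IsLocallyFinitelyPresentable.{v} C] (X : C) :
    ∃ (J : Type v) (_ : SmallCategory J) (_ : IsFiltered J) (p : ColimitPresentation J X),
      ∀ j, IsFinitelyPresentable.{v} (p.diag.obj j) := by
  have : Fact (Cardinal.aleph0.{v}).IsRegular := Cardinal.fact_isRegular_aleph0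
  obtain ⟨G, _, hG⟩ := HasCardinalFilteredGenerator.exists_generator C Cardinal.aleph0.{v}
  obtain ⟨J, _, hJ, ⟨p⟩⟩ := hG.exists_colimitsOfShape X
  exact ⟨J, inferInstance, (isCardinalFiltered_aleph0_iff J).1 hJ, p.toColimitPresentation,
    fun j => hG.le_isCardinalPresentable _ (p.prop_diag_obj j)⟩

theorem hom_ext_of_presentable [IsLocallyFinitelyPresentable.{v} C] {X Y : C} {f g : X ⟶ Y}
    (h : ∀ (P : C) [IsFinitelyPresentable.{v} P] (p : P ⟶ X), p ≫ f = p ≫ g) : f = g := by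
  obtain ⟨J, _, _, p, hp⟩ := exists_colimitPresentation X
  exact p.isColimit.hom_ext fun j => by
    have := hp j
    exact h _ _

variable [Abelian C]

theorem factors_iff_comp_cokernel_eq_zero {X Y : C} (A : Subobject X) (f : Y ⟶ X) :
    A.Factors f ↔ f ≫ cokernel.π A.arrow = 0 := by
  constructor
  · intro h
    rw [← Subobject.factorThru_arrow _ _ h, Category.assoc, cokernel.condition, comp_zero]
  · intro h
    rw [← Abelian.monoLift_comp A.arrow f h]
    exact Subobject.factors_comp_arrow _

theorem imageSubobject_factors_self {X Y : C} (f : X ⟶ Y) : (imageSubobject f).Factors f := by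
  simpa using imageSubobject_factors_comp_self f (𝟙 X)

variable [IsGrothendieckAbelian.{v} C]

section Directed

variable {X : C} {J : Type v} [Preorder J] (D : J →o Subobject X)

/-- The directed system of the members of a monotone family of subobjects. -/
noncomputable abbrev systemOfSubobjects : J ⥤ C := D.monotone.functor ⋙ Subobject.underlying

/-- The sum of a directed family of subobjects, as a cocone. -/
noncomputable abbrev supCocone : Cocone (systemOfSubobjects D) where
  pt := ((⨆ j, D j : Subobject X) : C)
  ι :=
    { app := fun j => Subobject.ofLE (D j) _ (le_iSup D j)
      naturality := fun i j f => by
        rw [← cancel_mono (Subobject.arrow _)]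
        have h := Subobject.underlying_arrow (D.monotone.functor.map f)
        dsimp at h ⊢
        rw [Category.comp_id, Category.assoc, Subobject.ofLE_arrow, Subobject.ofLE_arrow]
        exact h }

/-- The sum of a directed family of subobjects is its colimit. -/
noncomputable def isColimitSupCocone [IsDirectedOrder J] [Nonempty J] :
    IsColimit (supCocone D) := by
  let F : J ⥤ MonoOver X := D.monotone.functor ⋙ Subobject.representative
  let c : Cocone (F ⋙ MonoOver.forget X) :=
    { pt := Over.mk (⨆ j, D j : Subobject X).arrow
      ι :=
        { app := fun j => Over.homMk (Subobject.ofLE (D j) _ (le_iSup D j)) (by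
            exact Subobject.ofLE_arrow _)
          naturality := fun i j f => by
            ext
            exact (supCocone D).ι.naturality f } }
  have : Mono c.pt.hom := by dsimp [c]; infer_instance
  have h : Subobject.mk c.pt.hom = ⨆ j, Subobject.mk (F.obj j).obj.hom := by
    have : ∀ j, Subobject.mk (F.obj j).obj.hom = D j := fun j => Subobject.mk_arrow (D j)
    simp only [this]
    exact Subobject.mk_arrow _
  exact IsGrothendieckAbelian.isColimitMapCoconeOfSubobjectMkEqISup F c h

/-- A set of subobjects, reindexed by a small type. -/
noncomputable def familyOfSet (T : Set (Subobject X)) : Shrink.{v} T →o Subobject X where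
  toFun j := ((equivShrink T).symm j).1
  monotone' _ _ h := h

theorem familyOfSet_mem (T : Set (Subobject X)) (j : Shrink.{v} T) : familyOfSet T j ∈ T :=
  ((equivShrink T).symm j).2

theorem exists_familyOfSet_eq {T : Set (Subobject X)} {A : Subobject X} (hA : A ∈ T) :
    ∃ j, familyOfSet T j = A :=
  ⟨equivShrink T ⟨A, hA⟩, by
    change ((equivShrink T).symm (equivShrink T ⟨A, hA⟩)).1 = A
    simp⟩

theorem iSup_familyOfSet (T : Set (Subobject X)) : ⨆ j, familyOfSet T j = sSup T := by
  apply le_antisymm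
  · exact iSup_le fun j => le_sSup (familyOfSet_mem T j)
  · refine sSup_le fun A hA => ?_
    obtain ⟨j, rfl⟩ := exists_familyOfSet_eq hA
    exact le_iSup (familyOfSet T) j

theorem nonempty_shrink {T : Set (Subobject X)} (h : T.Nonempty) : Nonempty (Shrink.{v} T) :=
  let ⟨A, hA⟩ := h
  ⟨equivShrink T ⟨A, hA⟩⟩

theorem isDirectedOrder_shrink {T : Set (Subobject X)} (h : DirectedOn (· ≤ ·) T) :
    IsDirectedOrder (Shrink.{v} T) where
  directed a b := by
    obtain ⟨A, hA, h₁, h₂⟩ := h _ (familyOfSet_mem T a) _ (familyOfSet_mem T b)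
    obtain ⟨j, rfl⟩ := exists_familyOfSet_eq hA
    exact ⟨j, h₁, h₂⟩

/-- The sum is a directed colimit, so a morphism to it from a finitely presentable object factors
through one stage. This is what makes the applications of Zorn's lemma work. -/
theorem exists_factors_of_directed {P : C} [IsFinitelyPresentable.{v} P]
    {T : Set (Subobject X)} (hT : T.Nonempty) (hd : DirectedOn (· ≤ ·) T) (f : P ⟶ X)
    (hf : (sSup T).Factors f) : ∃ A ∈ T, A.Factors f := by
  have := nonempty_shrink hT
  have := isDirectedOrder_shrink hd
  rw [← iSup_familyOfSet] at hf
  obtain ⟨j, p, hp⟩ := IsFinitelyPresentable.exists_hom_of_isColimit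
    (isColimitSupCocone (familyOfSet T)) (Subobject.factorThru _ f hf)
  refine ⟨_, familyOfSet_mem T j, ?_⟩
  have : f = p ≫ (familyOfSet T j).arrow := by
    rw [← Subobject.factorThru_arrow _ f hf, ← hp]
    exact (Category.assoc _ _ _).trans (congrArg (p ≫ ·) (Subobject.ofLE_arrow _))
  rw [this]
  exact Subobject.factors_comp_arrow p

end Directed

section Presentable

theorem isFinitelyPresentable_biprod (P Q : C) [IsFinitelyPresentable.{v} P]
    [IsFinitelyPresentable.{v} Q] : IsFinitelyPresentable.{v} (P ⊞ Q) := by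
  have : Fact (Cardinal.aleph0.{v}).IsRegular := Cardinal.fact_isRegular_aleph0
  have := isClosedUnderColimitsOfShape_isCardinalPresentable (C := C)
    (κ := Cardinal.aleph0.{v}) (J := Discrete WalkingPair) (by
      rw [hasCardinalLT_aleph0_iff]; infer_instance)
  have : ObjectProperty.isFinitelyPresentable.{v} C (P ⨿ Q) := by
    apply ObjectProperty.prop_colimit (isCardinalPresentable C Cardinal.aleph0.{v})
    rintro ⟨_ | _⟩
    · assumption
    · assumption
  exact (isCardinalPresentable C Cardinal.aleph0.{v}).prop_of_iso (biprod.isoCoprod P Q).symm this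

variable [IsLocallyFinitelyPresentable.{v} C]

theorem le_of_presentable_factors {X : C} {A B : Subobject X}
    (h : ∀ (P : C) [IsFinitelyPresentable.{v} P] (p : P ⟶ X), A.Factors p → B.Factors p) :
    A ≤ B := by
  refine Subobject.le_of_factors ((factors_iff_comp_cokernel_eq_zero _ _).2
    (hom_ext_of_presentable fun P _ p => ?_))
  rw [comp_zero, ← Category.assoc, ← factors_iff_comp_cokernel_eq_zero]
  exact h P (p ≫ A.arrow) (Subobject.factors_comp_arrow p)

/-- A finitely presentable object is finitely generated: an epimorphism onto it stays an
epimorphism on a finitely presentable piece of its source. -/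
theorem exists_presentable_epi {X P : C} [IsFinitelyPresentable.{v} P] (e : X ⟶ P) [Epi e] :
    ∃ (Q : C) (_ : IsFinitelyPresentable.{v} Q) (q : Q ⟶ X), Epi (q ≫ e) := by
  -- The images in `P` of finitely presentable objects over `X` form a directed family with sum `P`;
  -- finite presentability of `P` then makes one of them all of `P`.
  let T : Set (Subobject P) := {A | ∃ (Q : C) (_ : IsFinitelyPresentable.{v} Q) (q : Q ⟶ X),
    A = imageSubobject (q ≫ e)}
  have hT : T.Nonempty := by
    obtain ⟨J, _, _, p, hp⟩ := exists_colimitPresentation X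
    obtain ⟨j⟩ := IsFiltered.nonempty (C := J)
    exact ⟨_, _, hp j, p.ι.app j, rfl⟩
  have hd : DirectedOn (· ≤ ·) T := by
    rintro _ ⟨Q₁, h₁, q₁, rfl⟩ _ ⟨Q₂, h₂, q₂, rfl⟩
    refine ⟨_, ⟨Q₁ ⊞ Q₂, isFinitelyPresentable_biprod _ _, biprod.desc q₁ q₂, rfl⟩, ?_, ?_⟩
    · have : q₁ ≫ e = biprod.inl ≫ biprod.desc q₁ q₂ ≫ e := by simp
      rw [this]
      exact imageSubobject_comp_le _ _
    · have : q₂ ≫ e = biprod.inr ≫ biprod.desc q₁ q₂ ≫ e := by simp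
      rw [this]
      exact imageSubobject_comp_le _ _
  have hs : (sSup T).Factors (𝟙 P) := by
    have h₀ : e ≫ cokernel.π (sSup T).arrow = 0 := hom_ext_of_presentable fun Q _ q => by
      have hle : imageSubobject (q ≫ e) ≤ sSup T := le_sSup ⟨Q, inferInstance, q, rfl⟩
      rw [comp_zero, ← Category.assoc, ← factors_iff_comp_cokernel_eq_zero]
      refine Subobject.factors_of_le _ hle ?_
      exact imageSubobject_factors_self _
    have h₁ : cokernel.π (sSup T).arrow = 0 := by rw [← cancel_epi e, h₀, comp_zero]
    have : Epi (sSup T).arrow := Abelian.epi_of_cokernel_π_eq_zero _ h₁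
    have := isIso_of_mono_of_epi (sSup T).arrow
    rw [Subobject.eq_top_of_isIso_arrow (sSup T)]
    exact Subobject.top_factors _
  obtain ⟨_, ⟨Q, hQ, q, rfl⟩, hA⟩ := exists_factors_of_directed hT hd (𝟙 P) hs
  refine ⟨Q, hQ, q, ?_⟩
  have : Epi (imageSubobject (q ≫ e)).arrow := by
    have : Epi (Subobject.factorThru _ _ hA ≫ (imageSubobject (q ≫ e)).arrow) := by
      rw [Subobject.factorThru_arrow]; infer_instance
    exact epi_of_epi (Subobject.factorThru _ _ hA) _
  rw [← imageSubobject_arrow_comp (q ≫ e)]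
  exact epi_comp _ _

end Presentable

end FiniteLocalization

/-! ### Serre subcategories, torsion subobjects and torsion-free objects. -/

namespace FiniteLocalization

variable {C : Type u} [Category.{v} C] [Abelian C]

/-- A morphism killed by the cokernel of `w` lifts to the source of `w` after an epimorphism. -/
theorem exists_epi_comp_eq_of_comp_cokernel_eq_zero {X Y Z : C} (w : X ⟶ Y) (k : Z ⟶ Y)
    (h : k ≫ cokernel.π w = 0) :
    ∃ (K : C) (s : K ⟶ Z) (_ : Epi s) (r : K ⟶ X), s ≫ k = r ≫ w :=
  (ShortComplex.exact_iff_exact_up_to_refinements _).1 (ShortComplex.exact_of_g_is_cokernel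
    (ShortComplex.mk w (cokernel.π w) (cokernel.condition w)) (cokernelIsCokernel w)) k h

/-- Used with Zorn's lemma: if `Z` is maximal for some property, it suffices that the kernel of the
composite from `X` has that property. -/
theorem mono_of_kernelSubobject_le {X Y : C} {Z : Subobject X} (a : cokernel Z.arrow ⟶ Y)
    (h : kernelSubobject (cokernel.π Z.arrow ≫ a) ≤ Z) : Mono a := by
  refine Preadditive.mono_of_cancel_zero _ fun {G} f hf => ?_
  have h₁ : pullback.snd f (cokernel.π Z.arrow) ≫ cokernel.π Z.arrow = 0 := by
    rw [← factors_iff_comp_cokernel_eq_zero]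
    refine Subobject.factors_of_le _ h (kernelSubobject_factors _ _ ?_)
    rw [← pullback.condition_assoc, hf, comp_zero]
  rw [← cancel_epi (pullback.fst f (cokernel.π Z.arrow)), comp_zero, pullback.condition, h₁]

section Serre

variable {S : ObjectProperty C} [S.IsSerreClass]

theorem prop_of_kernel {X Y : C} (f : X ⟶ Y) (hK : S (kernel f)) (hY : S Y) : S X :=
  S.prop_X₂_of_exact (ShortComplex.exact_of_f_is_kernel
    (ShortComplex.mk (kernel.ι f) f (kernel.condition f)) (kernelIsKernel f)) hK hY

theorem prop_of_cokernel {X Y : C} (f : X ⟶ Y) (hX : S X) (hQ : S (cokernel f)) : S Y :=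
  S.prop_X₂_of_exact (ShortComplex.exact_of_g_is_cokernel
    (ShortComplex.mk f (cokernel.π f) (cokernel.condition f)) (cokernelIsCokernel f)) hX hQ

theorem prop_coimage {X Y : C} (f : X ⟶ Y) (hY : S Y) : S (Abelian.coimage f) :=
  S.prop_of_mono (Abelian.factorThruCoimage f) hY

theorem prop_imageSubobject {X Y : C} (f : X ⟶ Y) (hX : S X) : S (imageSubobject f : C) :=
  S.prop_of_epi (factorThruImageSubobject f) hX

/-- If `g : B ⟶ X` has values in an object of `S` and its kernel is contained in the image of
`i : A ⟶ B`, then the cokernel of `i` belongs to `S`. -/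
theorem prop_cokernel_of_kernel {A B X : C} (i : A ⟶ B) (g : B ⟶ X) (hX : S X)
    (h : kernel.ι g ≫ cokernel.π i = 0) : S (cokernel i) := by
  let e : Abelian.coimage g ⟶ cokernel i := cokernel.desc _ _ h
  have : Epi (Abelian.coimage.π g ≫ e) := by
    rw [cokernel.π_desc]; infer_instance
  have : Epi e := epi_of_epi (Abelian.coimage.π g) e
  exact S.prop_of_epi e (prop_coimage g hX)

/-- Cokernels only get smaller when the morphism is enlarged. -/
theorem prop_cokernel_of_factor {A A' B : C} (i : A ⟶ B) (j : A' ⟶ B) (k : A ⟶ A')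
    (h : k ≫ j = i) (hi : S (cokernel i)) : S (cokernel j) := by
  let e : cokernel i ⟶ cokernel j :=
    cokernel.desc _ (cokernel.π j) (by rw [← h, Category.assoc, cokernel.condition, comp_zero])
  have : Epi (cokernel.π i ≫ e) := by rw [cokernel.π_desc]; infer_instance
  have : Epi e := epi_of_epi (cokernel.π i) e
  exact S.prop_of_epi e hi

theorem prop_cokernel_comp {A B D : C} (i : A ⟶ B) (j : B ⟶ D)
    (hi : S (cokernel i)) (hj : S (cokernel j)) : S (cokernel (i ≫ j)) := by
  let a : cokernel i ⟶ cokernel (i ≫ j) :=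
    cokernel.desc _ (j ≫ cokernel.π (i ≫ j)) (by rw [← Category.assoc, cokernel.condition])
  refine prop_of_cokernel a hi ?_
  have w : j ≫ cokernel.π (i ≫ j) ≫ cokernel.π a = 0 := by
    have h : cokernel.π i ≫ a = j ≫ cokernel.π (i ≫ j) := cokernel.π_desc _ _ _
    rw [← Category.assoc, ← h, Category.assoc, cokernel.condition, comp_zero]
  let e : cokernel j ⟶ cokernel a := cokernel.desc _ _ w
  have : Epi (cokernel.π j ≫ e) := by
    rw [cokernel.π_desc]; exact epi_comp _ _
  have : Epi e := epi_of_epi (cokernel.π j) e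
  exact S.prop_of_epi e hj

theorem prop_cokernel_of_comp_mono {A B D : C} (i : A ⟶ B) (j : B ⟶ D) [Mono j]
    (h : S (cokernel (i ≫ j))) : S (cokernel i) := by
  refine prop_cokernel_of_kernel i (j ≫ cokernel.π (i ≫ j)) h ?_
  obtain ⟨K, s, _, r, hr⟩ := exists_epi_comp_eq_of_comp_cokernel_eq_zero (i ≫ j)
    (kernel.ι (j ≫ cokernel.π (i ≫ j)) ≫ j) (by rw [Category.assoc, kernel.condition])
  have hr' : s ≫ kernel.ι (j ≫ cokernel.π (i ≫ j)) = r ≫ i := by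
    rw [← cancel_mono j, Category.assoc, Category.assoc, hr]
  rw [← cancel_epi s, comp_zero, ← Category.assoc, hr', Category.assoc, cokernel.condition,
    comp_zero]

theorem prop_sup [IsGrothendieckAbelian.{v} C] {X : C} {A B : Subobject X} (hA : S (A : C))
    (hB : S (B : C)) :
    S ((A ⊔ B : Subobject X) : C) := by
  let e : (A : C) ⊞ (B : C) ⟶ ((A ⊔ B : Subobject X) : C) :=
    biprod.desc (Subobject.ofLE _ _ le_sup_left) (Subobject.ofLE _ _ le_sup_right)
  have : Epi e := by
    have h : A ⊔ B ≤ imageSubobject (e ≫ (A ⊔ B).arrow) := by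
      refine sup_le (Subobject.le_of_factors ?_) (Subobject.le_of_factors ?_)
      · have : A.arrow = biprod.inl ≫ e ≫ (A ⊔ B).arrow := by simp [e]
        rw [this]
        exact imageSubobject_factors_comp_self (e ≫ (A ⊔ B).arrow) _
      · have : B.arrow = biprod.inr ≫ e ≫ (A ⊔ B).arrow := by simp [e]
        rw [this]
        exact imageSubobject_factors_comp_self (e ≫ (A ⊔ B).arrow) _
    have : factorThruImageSubobject (e ≫ (A ⊔ B).arrow) ≫
        Subobject.ofLE _ (A ⊔ B) (imageSubobject_le _ e rfl) = e := by
      rw [← cancel_mono (A ⊔ B).arrow]; simp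
    rw [← this]
    have : IsIso (Subobject.ofLE _ (A ⊔ B) (imageSubobject_le (e ≫ (A ⊔ B).arrow) e rfl)) :=
      ⟨Subobject.ofLE _ _ h, by simp, by simp⟩
    exact epi_comp _ _
  exact S.prop_of_epi e (S.prop_biprod hA hB)

end Serre

variable {S : ObjectProperty C}

/-- The objects that receive no nonzero morphism from an object of `S`. -/
def IsTorsionFree (S : ObjectProperty C) (Y : C) : Prop :=
  ∀ ⦃X : C⦄, S X → ∀ f : X ⟶ Y, f = 0

theorem IsTorsionFree.of_mono {X Y : C} (hY : IsTorsionFree S Y) (i : X ⟶ Y) [Mono i] :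
    IsTorsionFree S X := fun Z hZ f => by
  rw [← cancel_mono i, hY hZ (f ≫ i), zero_comp]

variable [IsGrothendieckAbelian.{v} C]

theorem IsLocalizing.prop_sSup (hS : IsLocalizing S) {X : C} {T : Set (Subobject X)}
    (hT : T.Nonempty) (hd : DirectedOn (· ≤ ·) T) (h : ∀ A ∈ T, S (A : C)) :
    S ((sSup T : Subobject X) : C) := by
  have := nonempty_shrink hT
  have := isDirectedOrder_shrink hd
  have := hS.closed_directLimit (Shrink.{v} T)
  rw [← iSup_familyOfSet]
  exact S.prop_of_isColimit (isColimitSupCocone (familyOfSet T)) fun j =>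
    h _ (familyOfSet_mem T j)

theorem IsLocalizing.prop_torsion (hS : IsLocalizing S) (X : C) : S (torsion S X : C) := by
  have := hS.isSerreClass
  refine hS.prop_sSup ⟨⊥, ?_⟩ ?_ fun A hA => hA
  · exact S.prop_of_iso (Subobject.botCoeIsoZero (B := X)).symm (S.prop_zero)
  · intro A hA B hB
    exact ⟨A ⊔ B, prop_sup hA hB, le_sup_left, le_sup_right⟩

theorem factors_torsion [S.IsSerreClass] {X Y : C} (f : X ⟶ Y) (hX : S X) :
    (torsion S Y).Factors f := by
  refine Subobject.factors_of_le f (le_sSup (prop_imageSubobject f hX)) ?_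
  exact imageSubobject_factors_self _

theorem torsion_eq_bot_iff [S.IsSerreClass] {Y : C} : torsion S Y = ⊥ ↔ IsTorsionFree S Y := by
  constructor
  · intro h X hX f
    have := factors_torsion f hX
    rwa [h, Subobject.bot_factors_iff_zero] at this
  · intro h
    refine le_bot_iff.1 (sSup_le fun A hA => ?_)
    exact Subobject.le_of_factors ((Subobject.bot_factors_iff_zero _).2 (h hA _))

/-- The pullback of `Z ⟶ X / t(X)` along the projection is an extension of `Z` by a subobject of
`t(X)`, up to an epimorphism onto `Z`; it is in `S`, so it lands in `t(X)` and the morphism from `Z`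
vanishes. -/
theorem IsLocalizing.isTorsionFree_cokernel (hS : IsLocalizing S) (X : C) :
    IsTorsionFree S (cokernel (torsion S X).arrow) := by
  intro Z hZ f
  have := hS.isSerreClass
  let π := cokernel.π (torsion S X).arrow
  have hk : S (kernel (pullback.fst f π)) := by
    have w : (kernel.ι (pullback.fst f π) ≫ pullback.snd f π) ≫ π = 0 := by
      rw [Category.assoc, ← pullback.condition, kernel.condition_assoc, zero_comp]
    have hm : Mono (kernel.ι (pullback.fst f π) ≫ pullback.snd f π) := by
      refine Preadditive.mono_of_cancel_zero _ fun g hg => ?_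
      rw [← cancel_mono (kernel.ι (pullback.fst f π))]
      apply pullback.hom_ext
      · simp
      · simpa using hg
    have : Mono (Abelian.monoLift (torsion S X).arrow _ w) := by
      have : Mono (Abelian.monoLift (torsion S X).arrow _ w ≫ (torsion S X).arrow) := by
        rw [Abelian.monoLift_comp]; exact hm
      exact mono_of_mono _ (torsion S X).arrow
    exact S.prop_of_mono (Abelian.monoLift (torsion S X).arrow _ w) (hS.prop_torsion X)
  have hN := prop_of_kernel _ hk hZ
  have h0 := (factors_iff_comp_cokernel_eq_zero _ _).1 (factors_torsion (pullback.snd f π) hN)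
  rw [← cancel_epi (pullback.fst f π), comp_zero, pullback.condition]
  exact h0

end FiniteLocalization

/-! ### Essential monomorphisms, uniform objects and injective hulls. -/

namespace FiniteLocalization

variable {C : Type u} [Category.{v} C]

/-- A monomorphism `i : V ⟶ E` is essential if a morphism out of `E` is a monomorphism as soon
as its restriction to `V` is. -/
structure IsEssentialMono {V E : C} (i : V ⟶ E) : Prop where
  mono : Mono i
  mono_of_comp : ∀ {Z : C} (g : E ⟶ Z), Mono (i ≫ g) → Mono g

theorem IsEssentialMono.comp {V D E : C} {i : V ⟶ D} {j : D ⟶ E} (hi : IsEssentialMono i)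
    (hj : IsEssentialMono j) : IsEssentialMono (i ≫ j) where
  mono := by
    have := hi.mono
    have := hj.mono
    exact mono_comp i j
  mono_of_comp g hg := hj.mono_of_comp g (hi.mono_of_comp _ (by rwa [← Category.assoc]))

theorem IsEssentialMono.of_isIso {V E : C} (i : V ⟶ E) [IsIso i] : IsEssentialMono i where
  mono := inferInstance
  mono_of_comp g hg := by
    have : g = inv i ≫ i ≫ g := by simp
    rw [this]
    exact mono_comp _ _

variable [Abelian C]

/-- An object is uniform if it cannot be embedded into a biproduct in a nontrivial way. -/
def IsUniform (V : C) : Prop :=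
  ¬ IsZero V ∧ ∀ {Y Z : C} (a : V ⟶ Y) (b : V ⟶ Z), Mono (biprod.lift a b) → Mono a ∨ Mono b

/-- If `E ≅ Y ⊞ Z`, uniformity makes one projection monic on `V`, hence on `E` by essentiality; the
other summand is its kernel and vanishes. -/
theorem IsUniform.indecomposable {V E : C} (hV : IsUniform V) {i : V ⟶ E}
    (hi : IsEssentialMono i) : Indecomposable E := by
  have := hi.mono
  refine ⟨fun hE => hV.1 ?_, fun Y Z e => ?_⟩
  · exact IsZero.of_mono i hE
  · have h : Mono (biprod.lift (i ≫ e.hom ≫ biprod.fst) (i ≫ e.hom ≫ biprod.snd)) := by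
      have : biprod.lift (i ≫ e.hom ≫ biprod.fst) (i ≫ e.hom ≫ biprod.snd) = i ≫ e.hom := by
        ext <;> simp
      rw [this]
      exact mono_comp _ _
    rcases hV.2 _ _ h with h | h
    · right
      have := hi.mono_of_comp _ h
      rw [IsZero.iff_id_eq_zero, ← cancel_mono (biprod.inr ≫ e.inv), ← cancel_mono
        (e.hom ≫ biprod.fst)]
      simp
    · left
      have := hi.mono_of_comp _ h
      rw [IsZero.iff_id_eq_zero, ← cancel_mono (biprod.inl ≫ e.inv), ← cancel_mono
        (e.hom ≫ biprod.snd)]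
      simp

theorem exists_iso_biprod_of_isSplitMono {A E : C} (h : A ⟶ E) [IsSplitMono h] :
    Nonempty (E ≅ A ⊞ cokernel h) := by
  let T : ShortComplex C := ShortComplex.mk h (cokernel.π h) (cokernel.condition h)
  have hT : T.ShortExact :=
    { exact := ShortComplex.exact_of_g_is_cokernel _ (cokernelIsCokernel h)
      mono_f := (inferInstance : Mono h)
      epi_g := (inferInstance : Epi (cokernel.π h)) }
  exact ⟨(ShortComplex.Splitting.ofExactOfRetraction T hT.exact (retraction h)
    (IsSplitMono.id h) hT.epi_g).isoBinaryBiproduct⟩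

variable [IsGrothendieckAbelian.{v} C]

/-- A subobject of `E` in `S` meets `V` in an object of `S`, hence trivially, so it is zero by
essentiality. -/
theorem IsEssentialMono.isTorsionFree {S : ObjectProperty C} [S.IsSerreClass] {V E : C}
    {i : V ⟶ E} (hi : IsEssentialMono i) (hV : IsTorsionFree S V) : IsTorsionFree S E := by
  intro X hX f
  have := hi.mono
  let A := imageSubobject f
  have : Mono (i ≫ cokernel.π A.arrow) := by
    refine Preadditive.mono_of_cancel_zero _ fun {G} g hg => ?_
    rw [← Category.assoc, ← factors_iff_comp_cokernel_eq_zero] at hg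
    have hp : S (pullback i A.arrow) :=
      S.prop_of_mono (pullback.snd i A.arrow) (prop_imageSubobject f hX)
    rw [← pullback.lift_fst g (A.factorThru _ hg) (Subobject.factorThru_arrow _ _ hg).symm,
      hV hp (pullback.fst i A.arrow), comp_zero]
  have := hi.mono_of_comp _ this
  refine zero_of_comp_mono (cokernel.π A.arrow) ?_
  rw [← factors_iff_comp_cokernel_eq_zero]
  exact imageSubobject_factors_self _

variable [IsLocallyFinitelyPresentable.{v} C]

/-- Every subobject has a complement up to essential extension: there is `B` for which
`D ⟶ I ⟶ I / B` is an essential monomorphism. -/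
theorem exists_isEssentialMono_cokernel {D I : C} (d : D ⟶ I) [Mono d] :
    ∃ B : Subobject I, IsEssentialMono (d ≫ cokernel.π B.arrow) := by
  -- `B` is maximal among the subobjects meeting `D` trivially.
  obtain ⟨B, -, hB⟩ := zorn_le_nonempty₀ {B : Subobject I | Mono (d ≫ cokernel.π B.arrow)}
    (by
      intro T hT hc B₀ hB₀
      refine ⟨sSup T, ?_, fun A hA => le_sSup hA⟩
      refine Preadditive.mono_of_cancel_zero _ fun {G} f hf => hom_ext_of_presentable
        fun P _ p => ?_
      have h₁ : (sSup T).Factors (p ≫ f ≫ d) := by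
        rw [factors_iff_comp_cokernel_eq_zero, Category.assoc, Category.assoc, hf, comp_zero]
      obtain ⟨A, hA, h₂⟩ := exists_factors_of_directed ⟨B₀, hB₀⟩ hc.directedOn _ h₁
      have : Mono (d ≫ cokernel.π A.arrow) := hT hA
      rw [comp_zero]
      refine zero_of_comp_mono (d ≫ cokernel.π A.arrow) ?_
      rw [factors_iff_comp_cokernel_eq_zero] at h₂
      simpa using h₂) ⊥ (by
      refine Preadditive.mono_of_cancel_zero _ fun {G} f hf => ?_
      rw [← Category.assoc, ← factors_iff_comp_cokernel_eq_zero,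
        Subobject.bot_factors_iff_zero] at hf
      exact zero_of_comp_mono d hf)
  refine ⟨B, hB.prop, fun {Z} g hg => ?_⟩
  have hle : B ≤ kernelSubobject (cokernel.π B.arrow ≫ g) := by
    apply le_kernelSubobject
    simp
  have hmem : Mono (d ≫ cokernel.π (kernelSubobject (cokernel.π B.arrow ≫ g)).arrow) := by
    have : Mono ((d ≫ cokernel.π (kernelSubobject (cokernel.π B.arrow ≫ g)).arrow) ≫
        cokernel.desc _ (cokernel.π B.arrow ≫ g) (kernelSubobject_arrow_comp _)) := by
      simpa using hg
    exact mono_of_mono _ (cokernel.desc _ (cokernel.π B.arrow ≫ g) (kernelSubobject_arrow_comp _))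
  exact mono_of_kernelSubobject_le g (hB.le_of_ge hmem hle)

/-- Inside `I`, a subobject has a maximal essential extension. -/
theorem exists_maximal_essential {V I : C} (v : V ⟶ I) [Mono v] :
    ∃ (D : C) (i : V ⟶ D) (d : D ⟶ I), IsEssentialMono i ∧ Mono d ∧ i ≫ d = v ∧
      ∀ (D' : C) (k : D ⟶ D') (d' : D' ⟶ I), Mono d' → IsEssentialMono k → k ≫ d' = d →
        IsIso k := by
  obtain ⟨D, -, hD⟩ := zorn_le_nonempty₀
    {D : Subobject I | ∃ h : Subobject.mk v ≤ D, IsEssentialMono (Subobject.ofMkLE v D h)}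
    (by
      intro T hT hc B₀ hB₀
      have hV : Subobject.mk v ≤ sSup T := (hT hB₀).choose.trans (le_sSup hB₀)
      refine ⟨sSup T, ⟨hV, inferInstance, fun {Z} g hg => ?_⟩, fun A hA => le_sSup hA⟩
      refine Preadditive.mono_of_cancel_zero _ fun {G} f hf => hom_ext_of_presentable
        fun P _ p => ?_
      obtain ⟨B, hB, h₂⟩ := exists_factors_of_directed ⟨B₀, hB₀⟩ hc.directedOn
        ((p ≫ f) ≫ (sSup T).arrow) (Subobject.factors_comp_arrow _)
      have hBT : B ≤ sSup T := le_sSup hB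
      obtain ⟨hVB, hess⟩ := hT hB
      have hm : Mono (Subobject.ofLE B _ hBT ≫ g) := hess.mono_of_comp _ (by
        rw [← Category.assoc, Subobject.ofMkLE_comp_ofLE]
        exact hg)
      have hp : p ≫ f = Subobject.factorThru B _ h₂ ≫ Subobject.ofLE B _ hBT := by
        rw [← cancel_mono (sSup T).arrow]
        simp
      have h0 : Subobject.factorThru B _ h₂ = 0 := by
        refine zero_of_comp_mono (Subobject.ofLE B _ hBT ≫ g) ?_
        rw [← Category.assoc, ← hp, Category.assoc, hf, comp_zero]
      rw [hp, h0, zero_comp, comp_zero]) (Subobject.mk v)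
    ⟨le_rfl, by
      have : IsIso (Subobject.ofMkLE v (Subobject.mk v) le_rfl) :=
        ⟨(Subobject.underlyingIso v).hom, by rw [← cancel_mono v]; simp, by
          rw [← cancel_mono (Subobject.mk v).arrow]; simp⟩
      exact .of_isIso _⟩
  obtain ⟨hVD, hess⟩ := hD.prop
  refine ⟨D, Subobject.ofMkLE v D hVD, D.arrow, hess, inferInstance, by simp, ?_⟩
  intro D' k d' _ hk hkd
  have hle : D ≤ Subobject.mk d' := Subobject.le_mk_of_comm k hkd
  have hmem := hD.le_of_ge (y := Subobject.mk d') ⟨hVD.trans hle, by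
    have : Subobject.ofMkLE v (Subobject.mk d') (hVD.trans hle) =
        Subobject.ofMkLE v D hVD ≫ k ≫ (Subobject.underlyingIso d').inv := by
      rw [← cancel_mono (Subobject.mk d').arrow]
      simp [hkd]
    rw [this]
    exact hess.comp (hk.comp (.of_isIso _))⟩ hle
  have hs : IsSplitEpi k := ⟨⟨⟨Subobject.ofMkLE d' D hmem, by
    rw [← cancel_mono d', Category.assoc, hkd]; simp⟩⟩⟩
  have := hk.mono
  exact isIso_of_mono_of_isSplitEpi k

/-- Every object has an injective hull. -/
theorem exists_injective_hull (V : C) :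
    ∃ (E : C) (i : V ⟶ E), Injective E ∧ IsEssentialMono i := by
  obtain ⟨D, i, d, hi, _, hid, hmax⟩ := exists_maximal_essential (Injective.ι V)
  refine ⟨D, i, ?_, hi⟩
  obtain ⟨B, hB⟩ := exists_isEssentialMono_cokernel d
  have := hB.mono
  -- Essentiality embeds `I / B` in `I` over `D`, so maximality of `D` makes `D ⟶ I / B` invertible
  -- and `D` a retract of the injective object `I`.
  let j := Injective.factorThru d (d ≫ cokernel.π B.arrow)
  have hj : (d ≫ cokernel.π B.arrow) ≫ j = d := Injective.comp_factorThru _ _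
  have hjm : Mono j := hB.mono_of_comp j (by rw [hj]; infer_instance)
  have := hmax _ _ j hjm hB hj
  let r : Retract D (Injective.under V) :=
    { i := d
      r := cokernel.π B.arrow ≫ inv (d ≫ cokernel.π B.arrow)
      retract := by rw [← Category.assoc, IsIso.hom_inv_id] }
  exact r.injective

/-- Nonzero subobjects of an indecomposable injective object are essential. -/
theorem isEssentialMono_of_indecomposable {A E : C} [Injective E] (hE : Indecomposable E)
    (a : A ⟶ E) [Mono a] (ha : a ≠ 0) : IsEssentialMono a := by
  -- The injective hull of `A` embeds in `E` as a nonzero direct summand, so it is all of `E`.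
  obtain ⟨H, i, _, hi⟩ := exists_injective_hull A
  have := hi.mono
  let h := Injective.factorThru a i
  have hih : i ≫ h = a := Injective.comp_factorThru _ _
  have : Mono h := hi.mono_of_comp h (by rw [hih]; infer_instance)
  have : IsSplitMono h := ⟨⟨⟨Injective.factorThru (𝟙 H) h, Injective.comp_factorThru _ _⟩⟩⟩
  obtain ⟨e⟩ := exists_iso_biprod_of_isSplitMono h
  rcases hE.2 _ _ e with hz | hz
  · exact absurd (by rw [← hih, hz.eq_of_src h 0, comp_zero]) ha
  · have : Epi h := Abelian.epi_of_cokernel_π_eq_zero _ (hz.eq_of_tgt _ _)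
    have := isIso_of_mono_of_epi h
    rw [← hih]
    exact hi.comp (.of_isIso h)

end FiniteLocalization

/-! ### Closed objects. -/

namespace FiniteLocalization

variable {C : Type u} [Category.{v} C] [Abelian C]

theorem shortExact_cokernel {A B : C} (i : A ⟶ B) [Mono i] :
    (ShortComplex.mk i (cokernel.π i) (cokernel.condition i)).ShortExact where
  exact := ShortComplex.exact_of_g_is_cokernel _ (cokernelIsCokernel i)
  mono_f := (inferInstance : Mono i)
  epi_g := (inferInstance : Epi (cokernel.π i))

variable [IsGrothendieckAbelian.{v} C] {S : ObjectProperty C}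

theorem isTorsionFree_of_closed {M : C} (hM : closedObjects S M) : IsTorsionFree S M :=
  fun X hX f => (hM X hX).1.elim f 0

/-- Morphisms to a closed object extend along monomorphisms with cokernel in `S`. -/
theorem exists_extension_of_closed {M A B : C} (hM : closedObjects S M) (i : A ⟶ B) [Mono i]
    (hi : S (cokernel i)) (f : A ⟶ M) : ∃ g : B ⟶ M, i ≫ g = f := by
  obtain ⟨x, hx⟩ := Abelian.Ext.contravariant_sequence_exact₁ (shortExact_cokernel i) M
    (Abelian.Ext.mk₀ f) (n₁ := 1) rfl ((hM _ hi).2.elim _ _)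
  obtain ⟨g, rfl⟩ := (Abelian.Ext.mk₀_bijective _ _).2 x
  refine ⟨g, (Abelian.Ext.mk₀_bijective _ _).1 ?_⟩
  rw [← hx, Abelian.Ext.mk₀_comp_mk₀]

/-- `Ext¹(X, K)` lies between `Hom(X, cokernel i)` and `Ext¹(X, M)` in the long exact sequence, and
both vanish. -/
theorem closed_of_shortExact {K M : C} (i : K ⟶ M) [Mono i] (hM : closedObjects S M)
    (hN : IsTorsionFree S (cokernel i)) : closedObjects S K := by
  intro X hX
  refine ⟨⟨fun f g => ?_⟩, subsingleton_of_forall_eq 0 fun x => ?_⟩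
  · have h := (isTorsionFree_of_closed hM).of_mono i
    rw [h hX f, h hX g]
  · obtain ⟨y, rfl⟩ := Abelian.Ext.covariant_sequence_exact₁ X (shortExact_cokernel i) x
      ((hM X hX).2.elim _ _) (n₀ := 0) rfl
    obtain ⟨g, rfl⟩ := (Abelian.Ext.mk₀_bijective _ _).2 y
    rw [hN hX g, Abelian.Ext.mk₀_zero, Abelian.Ext.zero_comp]

theorem closed_of_injective {E : C} [Injective E] (hE : IsTorsionFree S E) :
    closedObjects S E := fun X hX =>
  ⟨⟨fun f g => by rw [hE hX f, hE hX g]⟩, Abelian.Ext.subsingleton_of_injective X E 0⟩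

/-- Monomorphisms of the quotient category are monomorphisms. -/
theorem mono_hom_of_mono {M N : QuotientCategory S} (f : M ⟶ N) [Mono f] :
    Mono ((inclusion S).map f) := by
  let g : M.obj ⟶ N.obj := (inclusion S).map f
  have hK : closedObjects S (kernel g) := by
    refine closed_of_shortExact (kernel.ι g) M.property ?_
    exact (isTorsionFree_of_closed N.property).of_mono (Abelian.factorThruCoimage g)
  let k : (⟨kernel g, hK⟩ : QuotientCategory S) ⟶ M := ObjectProperty.homMk (kernel.ι g)
  have hk : k = 0 := by
    rw [← cancel_mono f]
    apply (inclusion S).map_injective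
    rw [zero_comp, Functor.map_comp, Functor.map_zero]
    exact kernel.condition g
  have : kernel.ι g = 0 := by
    have h : (inclusion S).map k = 0 := by rw [hk, Functor.map_zero]
    exact h
  exact Abelian.mono_of_kernel_ι_eq_zero g this

variable [IsLocallyFinitelyPresentable.{v} C]

/-- To check that an object is closed, it suffices to extend morphisms to finitely presentable
objects. -/
theorem closed_of_presentable_extension [S.IsSerreClass] {M : C} (hM : IsTorsionFree S M)
    (h : ∀ (P : C) [IsFinitelyPresentable.{v} P] {Y : C} (i : Y ⟶ P) [Mono i],
      S (cokernel i) → ∀ f : Y ⟶ M, ∃ g : P ⟶ M, i ≫ g = f) : closedObjects S M := by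
  obtain ⟨E, ι, _, hι⟩ := exists_injective_hull M
  have := hι.mono
  have hE := hι.isTorsionFree hM
  refine closed_of_shortExact ι (closed_of_injective hE) fun X hX g => ?_
  refine hom_ext_of_presentable fun P _ p => ?_
  -- It suffices that the hull modulo `M` is torsion-free. After a finitely presentable cover `Q` of
  -- `P`, `p ≫ g` lifts to `u : Q ⟶ E`.
  obtain ⟨Q, _, q, hq⟩ := exists_presentable_epi (pullback.fst (p ≫ g) (cokernel.π ι))
  let u : Q ⟶ E := q ≫ pullback.snd (p ≫ g) (cokernel.π ι)
  have hu : u ≫ cokernel.π ι = (q ≫ pullback.fst (p ≫ g) (cokernel.π ι)) ≫ p ≫ g := by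
    simp only [u, Category.assoc, pullback.condition]
  let a : Q ⟶ X := (q ≫ pullback.fst (p ≫ g) (cokernel.π ι)) ≫ p
  have hua : u ≫ cokernel.π ι = a ≫ g := by rw [hu]; simp [a]
  have w : (kernel.ι a ≫ u) ≫ cokernel.π ι = 0 := by
    rw [Category.assoc, hua, kernel.condition_assoc, zero_comp]
  -- On the kernel of `a : Q ⟶ X` the lift `u` lands in `M`; its extension `l` differs from `u` by a
  -- morphism from an object of `S` to the torsion-free `E`, so `u` itself lands in `M`.
  obtain ⟨l, hl⟩ := h Q (kernel.ι a) (prop_coimage a hX) (Abelian.monoLift ι _ w)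
  have h0 : kernel.ι a ≫ (u - l ≫ ι) = 0 := by
    rw [Preadditive.comp_sub, ← Category.assoc _ l, hl, Abelian.monoLift_comp, sub_self]
  have h1 : u - l ≫ ι = 0 := by
    rw [← cokernel.π_desc (kernel.ι a) _ h0,
      hE (prop_coimage a hX) (cokernel.desc (kernel.ι a) _ h0), comp_zero]
  rw [← cancel_epi (q ≫ pullback.fst (p ≫ g) (cokernel.π ι)), ← hu, sub_eq_zero.1 h1,
    Category.assoc, cokernel.condition]
  simp

end FiniteLocalization

/-! ### Saturation, and finite type as a condition on finitely presentable objects. -/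

namespace FiniteLocalization

variable {C : Type u} [Category.{v} C] [Abelian C] [IsGrothendieckAbelian.{v} C]
  {S : ObjectProperty C}

/-- The saturation of a subobject `A` of `E`: the largest subobject containing `A` whose quotient
by `A` belongs to `S`. -/
noncomputable def saturation (S : ObjectProperty C) {E : C} (A : Subobject E) : Subobject E :=
  kernelSubobject (cokernel.π A.arrow ≫ cokernel.π (torsion S (cokernel A.arrow)).arrow)

theorem saturation_factors_iff {E Z : C} (A : Subobject E) (p : Z ⟶ E) :
    (saturation S A).Factors p ↔
      (torsion S (cokernel A.arrow)).Factors (p ≫ cokernel.π A.arrow) := by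
  rw [saturation, kernelSubobject_factors_iff, factors_iff_comp_cokernel_eq_zero, Category.assoc]

theorem le_saturation {E : C} (A : Subobject E) : A ≤ saturation S A := by
  refine Subobject.le_of_factors ((saturation_factors_iff _ _).2 ?_)
  rw [cokernel.condition]
  exact Subobject.factors_zero

theorem saturation_mono [S.IsSerreClass] (hS : IsLocalizing S) {E : C} {A B : Subobject E}
    (h : A ≤ B) : saturation S A ≤ saturation S B := by
  refine Subobject.le_of_factors ((saturation_factors_iff _ _).2 ?_)
  have h₁ := (saturation_factors_iff A _).1 (Subobject.factors_self (saturation S A))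
  let m : cokernel A.arrow ⟶ cokernel B.arrow := cokernel.desc _ (cokernel.π B.arrow)
    ((factors_iff_comp_cokernel_eq_zero _ _).1
      (Subobject.factors_of_le _ h (Subobject.factors_self A)))
  have hm : (saturation S A).arrow ≫ cokernel.π B.arrow =
      (torsion S (cokernel A.arrow)).factorThru _ h₁ ≫ (torsion S (cokernel A.arrow)).arrow ≫ m := by
    simp [m]
  rw [hm]
  exact Subobject.factors_of_factors_right _ (factors_torsion _ (hS.prop_torsion _))

/-- The quotient of `E` by the saturation embeds in `E / A` modulo its torsion, which is
torsion-free. -/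
theorem closed_saturation (hS : IsLocalizing S) {E : C} [Injective E] (hE : IsTorsionFree S E)
    (A : Subobject E) : closedObjects S (saturation S A : C) := by
  refine closed_of_shortExact (saturation S A).arrow (closed_of_injective hE) ?_
  let g := cokernel.π A.arrow ≫ cokernel.π (torsion S (cokernel A.arrow)).arrow
  let d : cokernel (saturation S A).arrow ⟶ _ := cokernel.desc _ g (kernelSubobject_arrow_comp g)
  have hd : cokernel.π (saturation S A).arrow ≫ d = g := cokernel.π_desc _ _ _
  have : Mono d := mono_of_kernelSubobject_le d (by
    rw [hd]
    exact le_rfl)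
  exact (hS.isTorsionFree_cokernel _).of_mono d

theorem prop_cokernel_saturation [S.IsSerreClass] (hS : IsLocalizing S) {E : C}
    (A : Subobject E) : S (cokernel (Subobject.ofLE A (saturation S A) (le_saturation A))) := by
  have h₁ := (saturation_factors_iff A _).1 (Subobject.factors_self (saturation S A))
  refine prop_cokernel_of_kernel _ ((torsion S (cokernel A.arrow)).factorThru _ h₁)
    (hS.prop_torsion _) ?_
  set t := (torsion S (cokernel A.arrow)).factorThru _ h₁ with ht
  have h₂ : A.Factors (kernel.ι t ≫ (saturation S A).arrow) := by
    rw [factors_iff_comp_cokernel_eq_zero, Category.assoc,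
      ← Subobject.factorThru_arrow _ _ h₁, ← ht, kernel.condition_assoc, zero_comp]
  have h₃ : kernel.ι t = A.factorThru _ h₂ ≫ Subobject.ofLE A _ (le_saturation A) := by
    rw [← cancel_mono (saturation S A).arrow]
    simp
  rw [h₃, Category.assoc, cokernel.condition, comp_zero]

/-- A localizing subcategory is finitely determined if a morphism from a finitely presentable
object `P` to an object of `S` vanishes on the image of a finitely presentable object whose
cokernel in `P` belongs to `S`. -/
def IsFinitelyDetermined (S : ObjectProperty C) : Prop :=
  ∀ ⦃X : C⦄, S X → ∀ (P : C) [IsFinitelyPresentable.{v} P] (f : P ⟶ X),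
    ∃ (Q : C) (_ : IsFinitelyPresentable.{v} Q) (q : Q ⟶ P), q ≫ f = 0 ∧ S (cokernel q)

variable {J : Type v} [Preorder J] [IsDirectedOrder J] [Nonempty J]

/-- If the inclusion of the quotient category preserves directed sums, then the sum of a directed
family of saturated subobjects of a torsion-free injective object is saturated. -/
theorem IsFiniteType.factors_iSup_saturation (hS : IsFiniteType S) {E : C} [Injective E]
    (hE : IsTorsionFree S E) (D : J →o Subobject E) (hD : ∀ j, closedObjects S (D j : C))
    {P : C} (p : P ⟶ E) (hp : (saturation S (⨆ j, D j)).Factors p) : (⨆ j, D j).Factors p := by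
  have := hS.isLocalizing.isSerreClass
  let U : Subobject E := ⨆ j, D j
  let W := saturation S U
  let F : J ⥤ QuotientCategory S := (closedObjects S).lift (systemOfSubobjects D) hD
  let hU : IsColimit (supCocone D) := isColimitSupCocone D
  let i : (U : C) ⟶ (W : C) := Subobject.ofLE U W (le_saturation U)
  let W' : QuotientCategory S := ⟨(W : C), closed_saturation hS.isLocalizing hE U⟩
  let c : Cocone F :=
    { pt := W'
      ι :=
        { app := fun j => ObjectProperty.homMk ((supCocone D).ι.app j ≫ i)
          naturality := fun j k f => by
            apply (inclusion S).map_injective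
            change (systemOfSubobjects D).map f ≫ (supCocone D).ι.app k ≫ i =
              ((supCocone D).ι.app j ≫ i) ≫ 𝟙 _
            rw [Category.comp_id, (supCocone D).w_assoc] } }
  have hext : ∀ s : Cocone F, ∃ g : (W : C) ⟶ s.pt.obj,
      i ≫ g = hU.desc ((inclusion S).mapCocone s) := fun s =>
    exists_extension_of_closed s.pt.property i (prop_cokernel_saturation hS.isLocalizing U) _
  -- In `C/S` the colimit is `W`: morphisms from `U` to a closed object extend uniquely to `W`,
  -- since `W / U` is in `S`. As the inclusion preserves this colimit, `W` is also the colimit in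
  -- `C`, which forces `U = W`.
  have hc : IsColimit c :=
    { desc := fun s => ObjectProperty.homMk (hext s).choose
      fac := fun s j => by
        apply (inclusion S).map_injective
        change ((supCocone D).ι.app j ≫ i) ≫ (hext s).choose = _
        rw [Category.assoc, (hext s).choose_spec, hU.fac]
        rfl
      uniq := fun s m hm => by
        apply (inclusion S).map_injective
        let m' : (W : C) ⟶ s.pt.obj := (inclusion S).map m
        change m' = (hext s).choose
        let δ : (W : C) ⟶ s.pt.obj := m' - (hext s).choose
        have h0 : i ≫ δ = 0 := by
          change i ≫ (m' - (hext s).choose) = 0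
          rw [Preadditive.comp_sub, (hext s).choose_spec, sub_eq_zero]
          refine hU.hom_ext fun j => ?_
          rw [hU.fac]
          have := congrArg (fun l => (inclusion S).map l) (hm j)
          refine (Category.assoc _ _ _).symm.trans this
        have h1 : δ = 0 := by
          rw [← cokernel.π_desc i δ h0, isTorsionFree_of_closed s.pt.property
            (prop_cokernel_saturation hS.isLocalizing U) (cokernel.desc i δ h0), comp_zero]
        exact sub_eq_zero.1 h1 }
  have := hS.preservesDirectedSums J F (fun j k f => by
    have hm : Mono ((inclusion S).map (F.map f)) := by
      exact (inferInstance : Mono (Subobject.ofLE (D j) (D k) (D.monotone f.le)))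
    exact (inclusion S).mono_of_mono_map hm)
  let hW : IsColimit ((inclusion S).mapCocone c) := isColimitOfPreserves (inclusion S) hc
  let r : (W : C) ⟶ (U : C) := hW.desc (supCocone D)
  have hr : r ≫ i = 𝟙 (W : C) := hW.hom_ext fun j => by
    rw [hW.fac_assoc]
    exact (Category.comp_id _).symm
  have : p = (W.factorThru p hp ≫ r) ≫ U.arrow := by
    have hi : U.arrow = i ≫ W.arrow := by simp [i]
    rw [hi, Category.assoc, reassoc_of% hr, Subobject.factorThru_arrow]
  rw [this]
  exact Subobject.factors_comp_arrow _

variable [IsLocallyFinitelyPresentable.{v} C]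

/-- The kernel of `f` is the sum of images of finitely presentable objects. In the hull `E` of `P`
modulo torsion, the saturations of these images have a saturated sum, through which `P` factors
because `P / ker f` is in `S`. Then `P` factors through one of them. -/
theorem IsFiniteType.isFinitelyDetermined (hS : IsFiniteType S) : IsFinitelyDetermined S := by
  intro X hX P _ f
  have hL := hS.isLocalizing
  have := hL.isSerreClass
  let π := cokernel.π (torsion S P).arrow
  obtain ⟨E, e, _, he⟩ := exists_injective_hull (cokernel (torsion S P).arrow)
  have := he.mono
  have hE : IsTorsionFree S E := he.isTorsionFree (hL.isTorsionFree_cokernel P)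
  let u : P ⟶ E := π ≫ e
  let T : Set (Subobject E) := {A | ∃ (Q : C) (_ : IsFinitelyPresentable.{v} Q) (q : Q ⟶ P),
    q ≫ f = 0 ∧ A = imageSubobject (q ≫ u)}
  have hT : T.Nonempty := ⟨_, P, inferInstance, 0, zero_comp, rfl⟩
  have hd : DirectedOn (· ≤ ·) T := by
    rintro _ ⟨Q₁, h₁, q₁, hq₁, rfl⟩ _ ⟨Q₂, h₂, q₂, hq₂, rfl⟩
    refine ⟨_, ⟨Q₁ ⊞ Q₂, isFinitelyPresentable_biprod _ _, biprod.desc q₁ q₂, ?_, rfl⟩, ?_, ?_⟩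
    · ext <;> simp [hq₁, hq₂]
    · have : q₁ ≫ u = biprod.inl ≫ biprod.desc q₁ q₂ ≫ u := by rw [biprod.inl_desc_assoc]
      rw [this]
      exact imageSubobject_comp_le _ _
    · have : q₂ ≫ u = biprod.inr ≫ biprod.desc q₁ q₂ ≫ u := by rw [biprod.inr_desc_assoc]
      rw [this]
      exact imageSubobject_comp_le _ _
  have := nonempty_shrink hT
  have := isDirectedOrder_shrink hd
  let D : Shrink.{v} T →o Subobject E :=
    { toFun := fun j => saturation S (familyOfSet T j)
      monotone' := fun j k h => saturation_mono hL ((familyOfSet T).monotone h) }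
  have hu : (saturation S (⨆ j, D j)).Factors u := by
    rw [saturation_factors_iff]
    have w : kernel.ι f ≫ u ≫ cokernel.π (⨆ j, D j).arrow = 0 :=
      hom_ext_of_presentable fun Q _ q => by
        obtain ⟨j, hj⟩ := exists_familyOfSet_eq (T := T) (A := imageSubobject ((q ≫ kernel.ι f) ≫ u))
          ⟨Q, inferInstance, q ≫ kernel.ι f, by simp, rfl⟩
        have hle : imageSubobject ((q ≫ kernel.ι f) ≫ u) ≤ ⨆ j, D j := by
          refine le_trans ?_ (le_iSup D j)
          rw [← hj]
          exact le_saturation _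
        have h := Subobject.factors_of_le _ hle (imageSubobject_factors_self _)
        rw [factors_iff_comp_cokernel_eq_zero] at h
        simpa using h
    rw [← cokernel.π_desc _ _ w]
    exact Subobject.factors_of_factors_right _ (factors_torsion _ (prop_coimage f hX))
  have hu' := hS.factors_iSup_saturation hE D (fun j => closed_saturation hL hE _) u hu
  obtain ⟨j, l, hl⟩ := IsFinitelyPresentable.exists_hom_of_isColimit (isColimitSupCocone D)
    (Subobject.factorThru _ u hu')
  obtain ⟨Q, hQ, q, hq, hA⟩ := familyOfSet_mem T j
  have hlu : (saturation S (imageSubobject (q ≫ u))).Factors u := by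
    rw [← hA]
    have : u = l ≫ (D j).arrow := by
      rw [← Subobject.factorThru_arrow _ u hu', ← hl]
      exact (Category.assoc _ _ _).trans (congrArg (l ≫ ·) (Subobject.ofLE_arrow _))
    rw [this]
    exact Subobject.factors_comp_arrow l
  refine ⟨Q, hQ, q, hq, ?_⟩
  let A := imageSubobject (q ≫ u)
  rw [saturation_factors_iff] at hlu
  -- The factorization through the saturation controls the cokernel modulo torsion; the torsion of
  -- `P` itself is dealt with in `h₂`.
  have h₁ : S (cokernel (q ≫ π)) := by
    have hfac : (torsion S (cokernel A.arrow)).Factors (e ≫ cokernel.π A.arrow) := by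
      rw [factors_iff_comp_cokernel_eq_zero] at hlu ⊢
      rw [← cancel_epi π]
      simpa [u] using hlu
    refine prop_cokernel_of_kernel _ (Subobject.factorThru _ _ hfac) (hL.prop_torsion _) ?_
    set t := Subobject.factorThru _ _ hfac with ht
    have hk : A.Factors (kernel.ι t ≫ e) := by
      rw [factors_iff_comp_cokernel_eq_zero, Category.assoc, ← Subobject.factorThru_arrow _ _ hfac,
        ← ht, kernel.condition_assoc, zero_comp]
    have hk' : (kernel.ι t ≫ e) ≫ cokernel.π (q ≫ u) = 0 := by
      rw [← Subobject.factorThru_arrow _ _ hk, Category.assoc,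
        imageSubobject_arrow_comp_eq_zero (cokernel.condition (q ≫ u)), comp_zero]
    obtain ⟨K, s, _, r, hr⟩ := exists_epi_comp_eq_of_comp_cokernel_eq_zero _ _ hk'
    have hs : s ≫ kernel.ι t = r ≫ q ≫ π := by
      rw [← cancel_mono e]
      simpa [u] using hr
    rw [← cancel_epi s, comp_zero, ← Category.assoc, hs, Category.assoc, cokernel.condition,
      comp_zero]
  have h₂ : S (cokernel ((torsion S P).arrow ≫ cokernel.π q)) := by
    let m : cokernel (q ≫ π) ⟶ cokernel ((torsion S P).arrow ≫ cokernel.π q) :=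
      cokernel.desc _ (cokernel.desc _ (cokernel.π q ≫ cokernel.π _) (by
        rw [← Category.assoc, cokernel.condition])) (by simp [π])
    have hm : cokernel.π q ≫ cokernel.π ((torsion S P).arrow ≫ cokernel.π q) =
        (π ≫ cokernel.π (q ≫ π)) ≫ m := by simp [m, π]
    have : Epi ((π ≫ cokernel.π (q ≫ π)) ≫ m) := by
      rw [← hm]
      exact epi_comp _ _
    have : Epi m := epi_of_epi (π ≫ cokernel.π (q ≫ π)) m
    exact S.prop_of_epi m h₁
  exact prop_of_cokernel _ (hL.prop_torsion P) h₂

/-- On `P`, a morphism from an object of `S` to the colimit lifts to a stage, and its restriction to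
`Q` dies at a later stage. There it factors through `cokernel q`, which is in `S`, so it is zero. -/
theorem IsFinitelyDetermined.isTorsionFree_of_isColimit (hS : IsFinitelyDetermined S)
    {F : J ⥤ C} {c : Cocone F} (hc : IsColimit c)
    (hF : ∀ j, IsTorsionFree S (F.obj j)) : IsTorsionFree S c.pt := by
  intro X hX g
  refine hom_ext_of_presentable fun P _ p => ?_
  obtain ⟨Q, _, q, hq, hQ⟩ := hS hX P p
  obtain ⟨j, l, hl⟩ := IsFinitelyPresentable.exists_hom_of_isColimit hc (p ≫ g)
  obtain ⟨k, a, b, hab⟩ := IsFinitelyPresentable.exists_eq_of_isColimit hc (q ≫ l)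
    (0 : Q ⟶ F.obj j) (by rw [Category.assoc, hl, reassoc_of% hq, zero_comp, zero_comp])
  have h0 : q ≫ l ≫ F.map a = 0 := by simpa using hab
  have h1 : l ≫ F.map a = 0 := by
    rw [← cokernel.π_desc q _ h0, hF k hQ (cokernel.desc q _ h0), comp_zero]
  rw [← hl, ← c.w a, ← Category.assoc, h1, zero_comp, comp_zero]

theorem mono_ι_of_mono {F : J ⥤ C} {c : Cocone F} (hc : IsColimit c)
    (hF : ∀ (i j : J) (f : i ⟶ j), Mono (F.map f)) (j : J) : Mono (c.ι.app j) := by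
  refine Preadditive.mono_of_cancel_zero _ fun {G} f hf => hom_ext_of_presentable fun P _ p => ?_
  obtain ⟨k, a, b, hab⟩ := IsFinitelyPresentable.exists_eq_of_isColimit hc (p ≫ f)
    (0 : P ⟶ F.obj j) (by rw [Category.assoc, hf, comp_zero, zero_comp])
  have := hF j k a
  rw [comp_zero]
  exact zero_of_comp_mono (F.map a) (by simpa using hab)

theorem IsFinitelyDetermined.closed_of_isColimit (hL : IsLocalizing S)
    (hS : IsFinitelyDetermined S) {F : J ⥤ C} {c : Cocone F} (hc : IsColimit c)
    (hm : ∀ (i j : J) (f : i ⟶ j), Mono (F.map f))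
    (hF : ∀ j, closedObjects S (F.obj j)) : closedObjects S c.pt := by
  have := hL.isSerreClass
  have htf := hS.isTorsionFree_of_isColimit hc fun j => isTorsionFree_of_closed (hF j)
  refine closed_of_presentable_extension htf fun P _ Y i _ hi f => ?_
  -- `Y` need not be finitely presentable, so it is replaced by `Q`: on `Q`, `f` lands in one stage,
  -- where it extends to `P`. The extension agrees with `f` on all of `Y` since the colimit is
  -- torsion-free.
  obtain ⟨Q, _, q, hq, hQ⟩ := hS hi P (cokernel.π i)
  let q' := Abelian.monoLift i q hq
  have hq' : q' ≫ i = q := Abelian.monoLift_comp _ _ _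
  obtain ⟨j, l, hl⟩ := IsFinitelyPresentable.exists_hom_of_isColimit hc (q' ≫ f)
  have := mono_ι_of_mono hc hm j
  have hker : kernel.ι q ≫ l = 0 := by
    refine zero_of_comp_mono (c.ι.app j) ?_
    have : kernel.ι q ≫ q' = 0 := by
      refine zero_of_comp_mono i ?_
      rw [Category.assoc, hq', kernel.condition]
    rw [Category.assoc, hl, reassoc_of% this, zero_comp]
  have hq'' : Abelian.coimage.π q ≫ Abelian.factorThruCoimage q = q := Abelian.coimage.fac q
  obtain ⟨g, hg⟩ := exists_extension_of_closed (hF j) (Abelian.factorThruCoimage q)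
    (prop_cokernel_of_factor q _ (Abelian.coimage.π q) hq'' hQ) (cokernel.desc _ l hker)
  have hqg : q ≫ g = l := by
    rw [← hq'', Category.assoc, hg]
    exact cokernel.π_desc _ _ _
  let g' : P ⟶ c.pt := g ≫ c.ι.app j
  refine ⟨g', ?_⟩
  have h0 : q' ≫ (i ≫ g' - f) = 0 := by
    rw [Preadditive.comp_sub, ← Category.assoc, hq', ← hl, ← hqg, Category.assoc, sub_self]
  have hS' : S (cokernel q') := prop_cokernel_of_comp_mono q' i (hq'.symm ▸ hQ)
  rw [← sub_eq_zero, ← cokernel.π_desc q' _ h0, htf hS' (cokernel.desc q' _ h0), comp_zero]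

theorem IsFinitelyDetermined.isFiniteType (hL : IsLocalizing S) (hS : IsFinitelyDetermined S) :
    IsFiniteType S where
  isLocalizing := hL
  preservesDirectedSums J _ _ _ F hF := by
    let c := colimit.cocone (F ⋙ inclusion S)
    have hc : closedObjects S c.pt := hS.closed_of_isColimit hL (colimit.isColimit _)
      (fun i j f => by
        have := hF i j f
        exact mono_hom_of_mono (F.map f)) (fun j => (F.obj j).property)
    let c' : Cocone F :=
      { pt := ⟨c.pt, hc⟩
        ι :=
          { app := fun j => ObjectProperty.homMk (c.ι.app j)
            naturality := fun i j f => by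
              apply (inclusion S).map_injective
              exact c.ι.naturality f } }
    have h : IsColimit ((inclusion S).mapCocone c') := colimit.isColimit (F ⋙ inclusion S)
    exact preservesColimit_of_preserves_colimit_cocone (isColimitOfReflects (inclusion S) h) h

end FiniteLocalization

/-! ### Intersections, joins and separation by indecomposable injectives. -/

namespace FiniteLocalization

open ZeroObject

variable {C : Type u} [Category.{v} C] [Abelian C]

theorem isLocalizing_inter {F : Set (ObjectProperty C)} (hF : ∀ S ∈ F, IsLocalizing S) :
    IsLocalizing (inter F) where
  isSerreClass :=
    { exists_zero := ⟨0, isZero_zero C, fun S hS => by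
        have := (hF S hS).isSerreClass
        exact S.prop_zero⟩
      prop_of_mono := fun f _ h S hS => by
        have := (hF S hS).isSerreClass
        exact S.prop_of_mono f (h S hS)
      prop_of_epi := fun f _ h S hS => by
        have := (hF S hS).isSerreClass
        exact S.prop_of_epi f (h S hS)
      prop_X₂_of_shortExact := fun hE h₁ h₃ S hS => by
        have := (hF S hS).isSerreClass
        exact S.prop_X₂_of_shortExact hE (h₁ S hS) (h₃ S hS) }
  closed_directLimit J _ _ :=
    { colimitsOfShape_le := by
        rintro X ⟨p⟩ S hS
        have := (hF S hS).closed_directLimit J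
        exact S.prop_of_isColimit p.isColimit fun j => p.prop_diag_obj j S hS }

theorem isLocalizing_surd (X : ObjectProperty C) : IsLocalizing (surd X) := by
  have : surd X = inter {S | IsLocalizing S ∧ X ≤ S} := by
    ext A
    exact ⟨fun h S hS => h S hS.1 hS.2, fun h S hS hX => h S ⟨hS, hX⟩⟩
  rw [this]
  exact isLocalizing_inter fun S hS => hS.1

theorem le_join {F : Set (ObjectProperty C)} {S : ObjectProperty C} (hS : S ∈ F) : S ≤ join F :=
  fun _ hA _ _ hT => hT _ ⟨S, hS, hA⟩

theorem join_le {F : Set (ObjectProperty C)} {T : ObjectProperty C} (hT : IsLocalizing T)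
    (h : ∀ S ∈ F, S ≤ T) : join F ≤ T :=
  fun _ hA => hA T hT fun B ⟨S, hS, hB⟩ => h S hS B hB

/-- Injectivity of `E` is what gives closure under subobjects. This class bounds a join from above
when all its members have no nonzero morphism to `E`. -/
theorem isLocalizing_hom_eq_zero (E : C) [Injective E] :
    IsLocalizing (fun X : C => ∀ f : X ⟶ E, f = 0) where
  isSerreClass :=
    { exists_zero := ⟨0, isZero_zero C, fun f => (isZero_zero C).eq_of_src _ _⟩
      prop_of_mono := fun i _ h f => by
        rw [← Injective.comp_factorThru f i, h (Injective.factorThru f i), comp_zero]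
      prop_of_epi := fun p _ h f => by rw [← cancel_epi p, h (p ≫ f), comp_zero]
      prop_X₂_of_shortExact := fun {T} hT h₁ h₃ f => by
        have := hT.epi_g
        rw [← hT.exact.g_desc f (h₁ _), h₃ (hT.exact.desc f (h₁ _)), comp_zero] }
  closed_directLimit J _ _ :=
    { colimitsOfShape_le := by
        rintro X ⟨p⟩ f
        exact p.isColimit.hom_ext fun j => by rw [p.prop_diag_obj j (_ ≫ f), comp_zero] }

section

variable [IsGrothendieckAbelian.{v} C] [IsLocallyFinitelyPresentable.{v} C]

/-- The objects `X` such that every morphism from a finitely presentable object `P` to `X` is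
killed by a finitely presentable object whose cokernel in `P` belongs to `T`. -/
def determinedObjects (T : ObjectProperty C) : ObjectProperty C := fun X =>
  ∀ (P : C) [IsFinitelyPresentable.{v} P] (f : P ⟶ X),
    ∃ (Q : C) (_ : IsFinitelyPresentable.{v} Q) (q : Q ⟶ P), q ≫ f = 0 ∧ T (cokernel q)

theorem isLocalizing_determinedObjects {T : ObjectProperty C} [T.IsSerreClass] :
    IsLocalizing (determinedObjects T) where
  isSerreClass :=
    { exists_zero := ⟨0, isZero_zero C, fun P _ f => ⟨P, inferInstance, 𝟙 P,
        (isZero_zero C).eq_of_tgt _ _, T.prop_of_isZero (isZero_cokernel_of_epi _)⟩⟩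
      prop_of_mono := fun i _ h P _ f => by
        obtain ⟨Q, hQ, q, hq, hT⟩ := h P (f ≫ i)
        exact ⟨Q, hQ, q, zero_of_comp_mono i (by rw [Category.assoc, hq]), hT⟩
      prop_of_epi := fun {X Y} e _ h P _ f => by
        -- `f` need not lift along `e`; it does after a finitely presentable cover of `P`, which
        -- does not affect the cokernel condition.
        obtain ⟨P', _, p, hp⟩ := exists_presentable_epi (pullback.fst f e)
        obtain ⟨Q, hQ, q, hq, hT⟩ := h P' (p ≫ pullback.snd f e)
        refine ⟨Q, hQ, q ≫ p ≫ pullback.fst f e, ?_, ?_⟩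
        · rw [Category.assoc, Category.assoc, pullback.condition, ← Category.assoc p,
            ← Category.assoc q, hq, zero_comp]
        · exact prop_cokernel_comp _ _ hT (T.prop_of_isZero (isZero_cokernel_of_epi _))
      prop_X₂_of_shortExact := fun {E} hE h₁ h₃ P _ f => by
        obtain ⟨Q, hQ, q, hq, hT⟩ := h₃ P (f ≫ E.g)
        have := hE.mono_f
        have w : (q ≫ f) ≫ E.g = 0 := by rw [Category.assoc, hq]
        obtain ⟨Q', hQ', q', hq', hT'⟩ := h₁ Q (hE.exact.lift (q ≫ f) w)
        refine ⟨Q', hQ', q' ≫ q, ?_, prop_cokernel_comp _ _ hT' hT⟩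
        rw [Category.assoc, ← hE.exact.lift_f (q ≫ f) w, reassoc_of% hq', zero_comp] }
  closed_directLimit J _ _ :=
    { colimitsOfShape_le := by
        rintro X ⟨p⟩ P _ f
        obtain ⟨j, g, hg⟩ := IsFinitelyPresentable.exists_hom_of_isColimit p.isColimit f
        obtain ⟨Q, hQ, q, hq, hT⟩ := p.prop_diag_obj j P g
        exact ⟨Q, hQ, q, by rw [← hg, reassoc_of% hq, zero_comp], hT⟩ }

theorem isFiniteType_join {F : Set (ObjectProperty C)} (hF : ∀ S ∈ F, IsFiniteType S) :
    IsFiniteType (join F) := by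
  have hL : IsLocalizing (join F) := isLocalizing_surd _
  have := hL.isSerreClass
  have : join F ≤ determinedObjects (join F) :=
    join_le isLocalizing_determinedObjects fun S hS X hX P _ f => by
      obtain ⟨Q, hQ, q, hq, hT⟩ := (hF S hS).isFinitelyDetermined hX P f
      exact ⟨Q, hQ, q, hq, le_join hS _ hT⟩
  exact IsFinitelyDetermined.isFiniteType hL fun X hX P _ f => this X hX P f

theorem isFinitelyDetermined_inter {F : Set (ObjectProperty C)} (hf : F.Finite)
    (hF : ∀ S ∈ F, IsFiniteType S) : IsFinitelyDetermined (inter F) := by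
  intro X hX P _ f
  induction F, hf using Set.Finite.induction_on with
  -- The empty intersection is all of `C`, so `q = 0` serves.
  | empty => exact ⟨P, inferInstance, 0, zero_comp, fun S hS => hS.elim⟩
  | @insert S F _ _ ih =>
    obtain ⟨Q₁, _, q₁, hq₁, h₁⟩ := ih (fun T hT => hF T (Or.inr hT))
      (fun T hT => hX T (Or.inr hT))
    obtain ⟨Q₂, _, q₂, hq₂, h₂⟩ :=
      (hF S (Or.inl rfl)).isFinitelyDetermined (hX S (Or.inl rfl)) P f
    refine ⟨Q₁ ⊞ Q₂, isFinitelyPresentable_biprod _ _, biprod.desc q₁ q₂, ?_, ?_⟩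
    · ext <;> simp [hq₁, hq₂]
    · intro T hT
      have := (hF T hT).isLocalizing.isSerreClass
      rcases hT with rfl | hT
      · exact prop_cokernel_of_factor q₂ _ biprod.inr (biprod.inr_desc _ _) h₂
      · exact prop_cokernel_of_factor q₁ _ biprod.inl (biprod.inl_desc _ _) (h₁ T hT)

theorem isFiniteType_inter {F : Set (ObjectProperty C)} (hf : F.Finite)
    (hF : ∀ S ∈ F, IsFiniteType S) : IsFiniteType (inter F) :=
  (isFinitelyDetermined_inter hf hF).isFiniteType
    (isLocalizing_inter fun S hS => (hF S hS).isLocalizing)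

/-- An object is in a localizing subcategory as soon as the images in it of finitely presentable
objects are. -/
theorem IsLocalizing.prop_of_presentable {S : ObjectProperty C} (hS : IsLocalizing S) {X : C}
    (h : ∀ (P : C) [IsFinitelyPresentable.{v} P] (f : P ⟶ X), S (imageSubobject f : C)) :
    S X := by
  have := hS.isSerreClass
  have ht : torsion S X = ⊤ := top_le_iff.1 (le_of_presentable_factors fun P _ p _ =>
    Subobject.factors_of_le p (le_sSup (h P p)) (imageSubobject_factors_self p))
  have := hS.prop_torsion X
  rw [ht] at this
  exact S.prop_of_iso (asIso (⊤ : Subobject X).arrow) this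

/-- Localizing subcategories of finite type are determined by the indecomposable injective objects
that are torsion-free for them. -/
theorem exists_indecomposable_injective {S Q : ObjectProperty C} (hS : IsLocalizing S)
    (hQ : IsFiniteType Q) (h : ¬ S ≤ Q) :
    ∃ E : C, Injective E ∧ Indecomposable E ∧ ¬ IsTorsionFree S E ∧ IsTorsionFree Q E := by
  have := hS.isSerreClass
  have := hQ.isLocalizing.isSerreClass
  obtain ⟨X, hX, hXQ⟩ : ∃ X, S X ∧ ¬ Q X := by
    by_contra! hh
    exact h fun X => hh X
  obtain ⟨P, _, f, hf⟩ : ∃ (P : C) (_ : IsFinitelyPresentable.{v} P) (f : P ⟶ X),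
      ¬ Q (imageSubobject f : C) := by
    by_contra! hh
    exact hXQ (hQ.isLocalizing.prop_of_presentable fun P _ f => hh P inferInstance f)
  -- Chains have upper bounds by finite determinacy: if `P / sSup T` were in `Q`, a finitely
  -- presentable `R` witnessing this would already map into one member of the chain.
  obtain ⟨Z, hfZ, hZ⟩ := zorn_le_nonempty₀ {Z : Subobject P | ¬ Q (cokernel Z.arrow)}
    (by
      intro T hT hc Z₀ hZ₀
      refine ⟨sSup T, fun hq => ?_, fun A hA => le_sSup hA⟩
      obtain ⟨R, _, r, hr, hR⟩ := hQ.isFinitelyDetermined hq P (cokernel.π _)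
      rw [← factors_iff_comp_cokernel_eq_zero] at hr
      obtain ⟨A, hA, hrA⟩ := exists_factors_of_directed ⟨Z₀, hZ₀⟩ hc.directedOn r hr
      exact hT hA (prop_cokernel_of_factor r A.arrow _ (Subobject.factorThru_arrow _ _ hrA) hR))
    (kernelSubobject f) (fun hq => by
      let d : cokernel (kernelSubobject f).arrow ⟶ (imageSubobject f : C) :=
        cokernel.desc _ (factorThruImageSubobject f) (by
          rw [← cancel_mono (imageSubobject f).arrow]; simp)
      have : Epi (cokernel.π _ ≫ d) := by
        rw [cokernel.π_desc]; infer_instance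
      have : Epi d := epi_of_epi (cokernel.π _) d
      exact hf (Q.prop_of_epi d hq))
  let V := cokernel Z.arrow
  have hVQ : ¬ Q V := hZ.prop
  have hVS : S V := by
    refine prop_cokernel_of_kernel _ f hX ?_
    rw [← factors_iff_comp_cokernel_eq_zero]
    exact Subobject.factors_of_le _ hfZ (kernelSubobject_factors _ _ (kernel.condition f))
  -- By maximality of `Z`, every proper quotient of `V` is in `Q`; uniformity and torsion-freeness
  -- both follow from this and `¬ Q V`.
  have hquot : ∀ {Y : C} (a : V ⟶ Y) [Epi a], ¬ Mono a → Q Y := by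
    intro Y a _ ha
    by_contra hY
    refine ha (mono_of_kernelSubobject_le a (hZ.le_of_ge ?_ ?_))
    · intro hq
      let d : cokernel (kernelSubobject (cokernel.π Z.arrow ≫ a)).arrow ⟶ Y :=
        cokernel.desc _ (cokernel.π Z.arrow ≫ a) (kernelSubobject_arrow_comp _)
      have : Epi (cokernel.π _ ≫ d) := by
        rw [cokernel.π_desc]; exact epi_comp _ _
      have : Epi d := epi_of_epi (cokernel.π _) d
      exact hY (Q.prop_of_epi d hq)
    · apply le_kernelSubobject
      simp
  have hV : IsUniform V := by
    refine ⟨fun h0 => hVQ (Q.prop_of_isZero h0), fun {Y Z} a b hab => ?_⟩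
    by_contra! hm
    have key : ∀ {Y : C} (a : V ⟶ Y), ¬ Mono a → Q (imageSubobject a : C) := fun a ha =>
      hquot (factorThruImageSubobject a) fun hm => ha (by
        rw [← imageSubobject_arrow_comp a]; exact mono_comp _ _)
    have : Mono (biprod.lift (factorThruImageSubobject a) (factorThruImageSubobject b)) := by
      have : Mono (biprod.lift (factorThruImageSubobject a) (factorThruImageSubobject b) ≫
          biprod.map (imageSubobject a).arrow (imageSubobject b).arrow) := by
        have : biprod.lift (factorThruImageSubobject a) (factorThruImageSubobject b) ≫
            biprod.map (imageSubobject a).arrow (imageSubobject b).arrow = biprod.lift a b := by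
          ext <;> simp
        rwa [this]
      exact mono_of_mono _ (biprod.map (imageSubobject a).arrow (imageSubobject b).arrow)
    exact hVQ (Q.prop_of_mono (biprod.lift (factorThruImageSubobject a)
      (factorThruImageSubobject b)) (Q.prop_biprod (key a hm.1) (key b hm.2)))
  -- A nonzero image in `V` of an object of `Q` would have its quotient in `Q`, hence `V` in `Q` by
  -- extension.
  have hVtf : IsTorsionFree Q V := by
    intro Y hY g
    by_contra hg
    refine hVQ (prop_of_cokernel g hY (hquot (cokernel.π g) fun hm => hg ?_))
    exact zero_of_comp_mono _ (cokernel.condition g)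
  obtain ⟨E, i, hE, hi⟩ := exists_injective_hull V
  have := hi.mono
  refine ⟨E, hE, hV.indecomposable hi, fun h0 => hV.1 ?_, hi.isTorsionFree hVtf⟩
  exact IsZero.of_mono_eq_zero i (h0 hVS i)

end

/-! ### The open sets of the injective spectrum. -/

section Spectrum

theorem InjSpectrum.exists_rep (x : InjSpectrum C) : ∃ E, InjSpectrum.mk E = x :=
  Quotient.exists_rep x

variable [IsGrothendieckAbelian.{v} C]

theorem mk_mem_openSet_iff {S : ObjectProperty C} [S.IsSerreClass]
    (E : (indecomposableInjectives C).FullSubcategory) :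
    InjSpectrum.mk E ∈ openSet S ↔ ¬ IsTorsionFree S E.obj := by
  constructor
  · rintro ⟨E', hE', ht⟩ h
    obtain ⟨e⟩ : Nonempty (E' ≅ E) := Quotient.exact hE'
    rw [Ne, torsion_eq_bot_iff] at ht
    exact ht (h.of_mono ((indecomposableInjectives C).ι.mapIso e).hom)
  · intro h
    exact ⟨E, rfl, by rwa [Ne, torsion_eq_bot_iff]⟩

theorem openSet_mono {S Q : ObjectProperty C} (hS : IsLocalizing S) (hQ : IsLocalizing Q)
    (h : S ≤ Q) : openSet S ⊆ openSet Q := by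
  have := hS.isSerreClass
  have := hQ.isSerreClass
  intro x
  obtain ⟨E, rfl⟩ := x.exists_rep
  rw [mk_mem_openSet_iff, mk_mem_openSet_iff]
  exact fun hE h' => hE fun X hX => h' (h X hX)

/-- The empty intersection is all of `C`, and the identity of an indecomposable object is nonzero.
-/
theorem openSet_inter_empty : openSet (inter (∅ : Set (ObjectProperty C))) = Set.univ := by
  have := (isLocalizing_inter (C := C) (F := ∅) (by simp)).isSerreClass
  refine Set.eq_univ_of_forall fun x => ?_
  obtain ⟨E, rfl⟩ := x.exists_rep
  rw [mk_mem_openSet_iff]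
  intro h
  refine E.property.2.1 ((IsZero.iff_id_eq_zero _).2 (h ?_ _))
  exact fun S hS => hS.elim

theorem openSet_join {F : Set (ObjectProperty C)} (hF : ∀ S ∈ F, IsLocalizing S) :
    openSet (join F) = ⋃ S ∈ F, openSet S := by
  apply subset_antisymm
  · intro x
    obtain ⟨E, rfl⟩ := x.exists_rep
    have := (isLocalizing_surd (union F)).isSerreClass
    have : Injective E.obj := E.property.1
    intro hx
    by_contra hn
    simp only [Set.mem_iUnion, not_exists] at hn
    refine (mk_mem_openSet_iff (S := surd (union F)) E).1 hx ?_
    have : join F ≤ fun X : C => ∀ f : X ⟶ E.obj, f = 0 :=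
      join_le (isLocalizing_hom_eq_zero E.obj) fun S hS X hX f => by
        have := (hF S hS).isSerreClass
        have h := hn S hS
        rw [mk_mem_openSet_iff, not_not] at h
        exact h hX f
    exact fun X hX f => this X hX f
  · exact Set.iUnion₂_subset fun S hS => openSet_mono (hF S hS) (isLocalizing_surd _) (le_join hS)

variable [IsLocallyFinitelyPresentable.{v} C]

theorem openSet_inter_pair {S Q : ObjectProperty C} (hS : IsLocalizing S) (hQ : IsLocalizing Q) :
    openSet (inter {S, Q}) = openSet S ∩ openSet Q := by
  have hSQ : IsLocalizing (inter {S, Q}) := isLocalizing_inter (by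
    rintro _ (rfl | rfl)
    · exact hS
    · exact hQ)
  have := hS.isSerreClass
  have := hQ.isSerreClass
  have := hSQ.isSerreClass
  apply subset_antisymm
  · exact Set.subset_inter (openSet_mono hSQ hS fun X hX => hX S (Or.inl rfl))
      (openSet_mono hSQ hQ fun X hX => hX Q (Or.inr rfl))
  · intro x
    obtain ⟨E, rfl⟩ := x.exists_rep
    rw [Set.mem_inter_iff, mk_mem_openSet_iff, mk_mem_openSet_iff, mk_mem_openSet_iff]
    rintro ⟨h₁, h₂⟩ h
    have := E.property.1
    refine h₂ fun Y hY g => ?_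
    by_contra hg
    refine h₁ fun X hX f => ?_
    by_contra hf
    -- `A` and `B` are nonzero subobjects of `E` in `S` and `Q`. Their intersection is in both,
    -- hence zero by `h`, contradicting essentiality of `A`.
    let A := imageSubobject f
    let B := imageSubobject g
    have hA : A.arrow ≠ 0 := fun h0 => hf (by rw [← imageSubobject_arrow_comp f, h0, comp_zero])
    have hess := isEssentialMono_of_indecomposable E.property.2 A.arrow hA
    have hp : inter {S, Q} (pullback A.arrow B.arrow) := by
      rintro _ (rfl | rfl)
      · exact ObjectProperty.prop_of_mono _ (pullback.fst A.arrow B.arrow) (prop_imageSubobject f hX)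
      · exact ObjectProperty.prop_of_mono _ (pullback.snd A.arrow B.arrow) (prop_imageSubobject g hY)
    have : Mono (A.arrow ≫ cokernel.π B.arrow) := by
      refine Preadditive.mono_of_cancel_zero _ fun {G} k hk => ?_
      rw [← Category.assoc, ← factors_iff_comp_cokernel_eq_zero] at hk
      refine zero_of_comp_mono A.arrow ?_
      rw [← pullback.lift_fst k (B.factorThru _ hk) (Subobject.factorThru_arrow _ _ hk).symm,
        Category.assoc, h hp (pullback.fst A.arrow B.arrow ≫ A.arrow), comp_zero]
    have := hess.mono_of_comp _ this
    have h0 : B.arrow = 0 := zero_of_comp_mono _ (cokernel.condition B.arrow)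
    exact hg (by rw [← imageSubobject_arrow_comp g, h0, comp_zero])

theorem le_iff_openSet_subset {S Q : ObjectProperty C} (hS : IsFiniteType S)
    (hQ : IsFiniteType Q) : S ≤ Q ↔ openSet S ⊆ openSet Q := by
  refine ⟨openSet_mono hS.isLocalizing hQ.isLocalizing, fun h => ?_⟩
  have := hS.isLocalizing.isSerreClass
  have := hQ.isLocalizing.isSerreClass
  by_contra hn
  obtain ⟨E, hE, hE', h₁, h₂⟩ := exists_indecomposable_injective hS.isLocalizing hQ hn
  exact (mk_mem_openSet_iff ⟨E, hE, hE'⟩).1 (h ((mk_mem_openSet_iff ⟨E, hE, hE'⟩).2 h₁)) h₂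

variable (C) in
/-- The topology on the injective spectrum whose open sets come from the localizing subcategories
of finite type. -/
abbrev flTopology : TopologicalSpace (InjSpectrum C) where
  IsOpen U := ∃ S : ObjectProperty C, IsFiniteType S ∧ openSet S = U
  isOpen_univ := ⟨_, isFiniteType_inter Set.finite_empty (by simp), openSet_inter_empty⟩
  isOpen_inter := by
    rintro _ _ ⟨S, hS, rfl⟩ ⟨Q, hQ, rfl⟩
    refine ⟨inter {S, Q}, isFiniteType_inter (by simp) ?_,
      openSet_inter_pair hS.isLocalizing hQ.isLocalizing⟩
    rintro _ (rfl | rfl)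
    · exact hS
    · exact hQ
  isOpen_sUnion := by
    intro s hs
    refine ⟨join {S | IsFiniteType S ∧ openSet S ∈ s}, isFiniteType_join fun S hS => hS.1, ?_⟩
    rw [openSet_join fun S hS => hS.1.isLocalizing]
    apply subset_antisymm
    · exact Set.iUnion₂_subset fun S hS => Set.subset_sUnion_of_mem hS.2
    · refine Set.sUnion_subset fun U hU => ?_
      obtain ⟨S, hS, rfl⟩ := hs U hU
      exact Set.subset_biUnion_of_mem (u := fun S => openSet S)
        (show S ∈ {S | IsFiniteType S ∧ openSet S ∈ s} from ⟨hS, hU⟩)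

end Spectrum

end FiniteLocalization

theorem mainTheorem4 (C : Type u) [Category.{v} C] [Abelian C] [IsGrothendieckAbelian.{v} C]
    [IsLocallyFinitelyPresentable.{v} C] :
    (∃ fl : TopologicalSpace (FiniteLocalization.InjSpectrum C),
      (∀ U : Set (FiniteLocalization.InjSpectrum C), IsOpen[fl] U ↔
        ∃ S : ObjectProperty C, FiniteLocalization.IsFiniteType S ∧
          FiniteLocalization.openSet S = U) ∧
      Set.BijOn (fun S : ObjectProperty C => FiniteLocalization.openSet S)
        {S | FiniteLocalization.IsFiniteType S} {U | IsOpen[fl] U} ∧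
      (∀ S Q : ObjectProperty C, FiniteLocalization.IsFiniteType S →
        FiniteLocalization.IsFiniteType Q →
        (S ≤ Q ↔ FiniteLocalization.openSet S ⊆ FiniteLocalization.openSet Q))) ∧
    (∀ F : Set (ObjectProperty C), F.Finite →
      (∀ S ∈ F, FiniteLocalization.IsFiniteType S) →
      FiniteLocalization.IsFiniteType (FiniteLocalization.inter F)) ∧
    (∀ F : Set (ObjectProperty C), (∀ S ∈ F, FiniteLocalization.IsFiniteType S) →
      FiniteLocalization.IsFiniteType (FiniteLocalization.join F)) := by
  refine ⟨⟨FiniteLocalization.flTopology C, fun U => Iff.rfl, ⟨?_, ?_, ?_⟩, ?_⟩, ?_, ?_⟩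
  · exact fun S hS => ⟨S, hS, rfl⟩
  · exact fun S hS Q hQ h => le_antisymm
      ((FiniteLocalization.le_iff_openSet_subset hS hQ).2 h.subset)
      ((FiniteLocalization.le_iff_openSet_subset hQ hS).2 h.symm.subset)
  · rintro U ⟨S, hS, rfl⟩
    exact ⟨S, hS, rfl⟩
  · exact fun S Q hS hQ => FiniteLocalization.le_iff_openSet_subset hS hQ
  · exact fun F hf hF => FiniteLocalization.isFiniteType_inter hf hF
  · exact fun F hF => FiniteLocalization.isFiniteType_join hF
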